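/- Let $n\ge 2$ and let $\alpha(1),\dots,\alpha(n+1)\in\mathbb Z^n$ be such that $\{\alpha(1),\dots,\alpha(n+1),0\}$ is a circuit (it is affinely dependent, but each of its proper subsets is affinely independent) and $0$ lies in the interior of $\operatorname{conv}\{\alpha(1),\dots,\alpha(n+1)\}\subset\mathbb R^n$. Let $b_1,\dots,b_{n+1}>0$ be real numbers and, for $c\in\mathbb R$, consider the Laurent polynomial $$f_c=\sum_{j=1}^{n+1} b_j\,\mathbf x^{\alpha(j)}+c .$$ For $\mathbf w\in\mathbb R^n$ put $$\Theta_{\mathbf w}=\sum_{j=1}^{n+1}\bigl|b_j e^{\langle \mathbf w,\alpha(j)\rangle}\bigr|,\qquad \Psi_{\mathbf w}=\max_{1\le j\le n+1}\bigl|b_j e^{\langle \mathbf w,\alpha(j)\rangle}\bigr| .$$ The amoeba $\mathcal A(f_c)\subset\mathbb R^n$ is the image of $\{\mathbf z\in(\mathbb C^*)^n: f_c(\mathbf z)=0\}$ under $\mathbf z\mapsto(\log|z_1|,\dots,\log|z_n|)$. Then for every $\mathbf w\in\mathbb R^n$ and every real $c\in[-\Theta_{\mathbf w},-\Psi_{\mathbf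 w}]$ we have $\mathbf w\in\mathcal A(f_c)$; equivalently, the fiber function $(S^1)^n\to\mathbb C$, $u\mapsto f_c(e^{w_1}u_1,\dots,e^{w_n}u_n)$, has a zero. This covers in particular polynomials in zero standard form, where $\alpha(j)=\mu e_j$ for all but one index $j$, and the remaining exponent is $-\frac{\mu}{\lambda_0}\sum_{i=1}^n\lambda_i e_i$, with $\lambda_0,\dots,\lambda_n\in\mathbb Q_{>0}$, $\sum_{i=0}^n\lambda_i=1$, and $\mu\in\mathbb N_{>0}$ the least common multiple of the denominators of the $\lambda_i$ (when this exponent is integral). -/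

import Mathlib

/-- Laurent polynomials in `n` variables with complex coefficients, `ℂ[z₁^±¹, …, zₙ^±¹]`:
finitely supported families of coefficients indexed by exponent vectors in `ℤⁿ`. -/
abbrev MvLaurent (n : ℕ) : Type := AddMonoidAlgebra ℂ (Fin n → ℤ)

/-- The value `z^a = ∏ᵢ zᵢ^(aᵢ)` of a Laurent monomial at a point of the torus `(ℂ^*)ⁿ`. -/
noncomputable def monomialValue {n : ℕ} (a : Fin n → ℤ) (z : Fin n → ℂˣ) : ℂ :=
  ∏ i, (z i : ℂ) ^ (a i)

/-- The value of a Laurent polynomial at a point of `(ℂ^*)ⁿ`. -/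
noncomputable def laurentEval {n : ℕ} (f : MvLaurent n) (z : Fin n → ℂˣ) : ℂ :=
  ∑ a ∈ f.coeff.support, f.coeff a * monomialValue a z

/-- The variety `V(f) ⊆ (ℂ^*)ⁿ` of a Laurent polynomial. -/
def torusVariety {n : ℕ} (f : MvLaurent n) : Set (Fin n → ℂˣ) :=
  {z | laurentEval f z = 0}

/-- The log-absolute-value map `(ℂ^*)ⁿ → ℝⁿ`. -/
noncomputable def logAbs {n : ℕ} (z : Fin n → ℂˣ) : Fin n → ℝ :=
  fun i => Real.log ‖(z i : ℂ)‖

/-- The amoeba of a Laurent polynomial. -/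
def amoeba {n : ℕ} (f : MvLaurent n) : Set (Fin n → ℝ) :=
  logAbs '' torusVariety f

/-- The point of `(ℂ^*)ⁿ` with coordinates `e^(wᵢ) · uᵢ`, where `|uᵢ| = 1`. For fixed `w` these are
exactly the points of the fiber of the log-absolute-value map over `w`. -/
noncomputable def fiberPoint {n : ℕ} (w : Fin n → ℝ) (u : Fin n → Circle) : Fin n → ℂˣ :=
  fun i => Units.mk0 (Complex.exp (w i) * (u i : ℂ))
    (mul_ne_zero (Complex.exp_ne_zero _) (Circle.coe_ne_zero _))

/-- The fiber function `(S¹)ⁿ → ℂ` of `f` over the point `w ∈ ℝⁿ`: the pullback of `f` to the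
torus `(S¹)ⁿ` along its identification with the fiber over `w`. -/
noncomputable def fiberFunction {n : ℕ} (f : MvLaurent n) (w : Fin n → ℝ) :
    (Fin n → Circle) → ℂ :=
  fun u => laurentEval f (fiberPoint w u)

/-- A lattice point of `ℤⁿ` seen in `ℝⁿ`. -/
def latticeToReal {n : ℕ} (a : Fin n → ℤ) : Fin n → ℝ := fun i => (a i : ℝ)

/-- A set of lattice points is a circuit if it is affinely dependent and each of its proper
subsets is affinely independent. -/
def IsCircuit {n : ℕ} (A : Set (Fin n → ℤ)) : Prop :=
  ¬ AffineIndependent ℝ (fun a : A => latticeToReal (a : Fin n → ℤ)) ∧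
    ∀ B : Set (Fin n → ℤ), B ⊂ A →
      AffineIndependent ℝ (fun a : B => latticeToReal (a : Fin n → ℤ))

/-- The exponents `α(1), …, α(n+1) ∈ ℤⁿ` form a circuit around the origin: together with `0` they
form a circuit, and `0` is an interior point of their convex hull. -/
def IsCircuitAroundZero {n : ℕ} (α : Fin (n + 1) → Fin n → ℤ) : Prop :=
  IsCircuit (insert 0 (Set.range α)) ∧
    (0 : Fin n → ℝ) ∈ interior (convexHull ℝ (Set.range fun j => latticeToReal (α j)))

/-- The Laurent polynomial `f_c = ∑ⱼ bⱼ x^α(j) + c`. -/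
noncomputable def circuitLaurent {n : ℕ} (α : Fin (n + 1) → Fin n → ℤ) (b : Fin (n + 1) → ℝ)
    (c : ℝ) : MvLaurent n :=
  (∑ j, AddMonoidAlgebra.single (α j) (b j : ℂ)) + AddMonoidAlgebra.single 0 (c : ℂ)

/-- `|bⱼ e^⟨w, α(j)⟩|`, the absolute value of the `j`-th outer term over `w`. -/
noncomputable def termAbs {n : ℕ} (α : Fin (n + 1) → Fin n → ℤ) (b : Fin (n + 1) → ℝ)
    (w : Fin n → ℝ) (j : Fin (n + 1)) : ℝ :=
  |b j * Real.exp (∑ i, w i * (α j i : ℝ))|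

/-- `Θ_w`, the sum of the absolute values of the outer terms over `w`. -/
noncomputable def thetaAt {n : ℕ} (α : Fin (n + 1) → Fin n → ℤ) (b : Fin (n + 1) → ℝ)
    (w : Fin n → ℝ) : ℝ :=
  ∑ j, termAbs α b w j

/-- `Ψ_w`, the maximum of the absolute values of the outer terms over `w`. -/
noncomputable def psiAt {n : ℕ} (α : Fin (n + 1) → Fin n → ℤ) (b : Fin (n + 1) → ℝ)
    (w : Fin n → ℝ) : ℝ :=
  Finset.univ.sup' Finset.univ_nonempty (termAbs α b w)

/-! The exponents span a simplex with `0` inside; let `l j > 0` be the barycentric coordinates of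
`0`. Phases `φ j` have the form `⟨θ, α(j)⟩` exactly when `∑ l j * φ j = 0`. So it suffices to make
vectors of lengths `t j`, with `max t ≤ C ≤ ∑ t` and `C = -c`, add up to `C` under this linear
constraint on their phases (`exists_phases`).

Induct on the number of vectors. If `C` minus the shortest length still bounds the others, point the
shortest along `C` and drop it. Otherwise freeze all but the two longest into a rigid group with
small resultant `ρ`, giving a four-bar linkage whose crank `ρ` turns fully: the weighted phase is a
positive multiple of the crank angle plus a bounded term, hence surjective. With three vectors the
crank may stop at a dead point; there the two assembly modes merge, so a configuration deforms into
its mirror image, its weighted phase changes sign, and it vanishes on the way. -/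

/-! ### Triangles and polygons -/

/-- The angle between the sides of lengths `a` and `r` in a triangle with sides `a`, `b`, `r`. -/
noncomputable def triangleAngle (a b r : ℝ) : ℝ :=
  Real.arccos ((r ^ 2 + a ^ 2 - b ^ 2) / (2 * a * r))

theorem triangleAngle_mem {a b r : ℝ} (ha : 0 < a) (hr : 0 < r)
    (h1 : a ≤ b + r) (h2 : b ≤ a + r) (h3 : r ≤ a + b) :
    a * Real.cos (triangleAngle a b r) = (r ^ 2 + a ^ 2 - b ^ 2) / (2 * r) ∧
      a * Real.sin (triangleAngle a b r) =
        √(a ^ 2 - ((r ^ 2 + a ^ 2 - b ^ 2) / (2 * r)) ^ 2) := by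
  have hb : 0 ≤ b := by linarith
  have hpos : 0 < 2 * a * r := by positivity
  constructor
  · rw [triangleAngle, Real.cos_arccos]
    · field_simp
    · rw [le_div_iff₀ hpos]; nlinarith
    · rw [div_le_iff₀ hpos]; nlinarith
  · rw [triangleAngle, Real.sin_arccos]
    nth_rewrite 1 [← Real.sqrt_sq ha.le]
    rw [← Real.sqrt_mul (sq_nonneg a)]
    congr 1
    field_simp

/-- Both sides have the same height over the base `r`, so the imaginary parts cancel; their
projections fill the base. -/
theorem triangleAngle_add {a b r : ℝ} (ha : 0 < a) (hb : 0 < b) (hr : 0 < r)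
    (h1 : a ≤ b + r) (h2 : b ≤ a + r) (h3 : r ≤ a + b) :
    a * Complex.exp (triangleAngle a b r * Complex.I) +
      b * Complex.exp (-triangleAngle b a r * Complex.I) = r := by
  obtain ⟨c1, s1⟩ := triangleAngle_mem ha hr h1 h2 h3
  obtain ⟨c2, s2⟩ := triangleAngle_mem hb hr h2 h1 (by linarith)
  have hs : a * Real.sin (triangleAngle a b r) = b * Real.sin (triangleAngle b a r) := by
    rw [s1, s2]
    congr 1
    field_simp
    ring
  have hc : a * Real.cos (triangleAngle a b r) + b * Real.cos (triangleAngle b a r) = r := by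
    rw [c1, c2]
    field_simp
    ring
  rw [← Complex.ofReal_neg, Complex.exp_mul_I, Complex.exp_mul_I, ← Complex.ofReal_cos,
    ← Complex.ofReal_cos, ← Complex.ofReal_sin, ← Complex.ofReal_sin, Real.cos_neg, Real.sin_neg]
  have hs' : (a : ℂ) * (Real.sin (triangleAngle a b r) : ℂ) =
      b * (Real.sin (triangleAngle b a r) : ℂ) := by exact_mod_cast hs
  have hc' : (a : ℂ) * (Real.cos (triangleAngle a b r) : ℂ) +
      b * (Real.cos (triangleAngle b a r) : ℂ) = r := by exact_mod_cast hc
  rw [Complex.ofReal_neg]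
  linear_combination hc' + Complex.I * hs'

theorem triangleAngle_sub {a b r : ℝ} (ha : 0 < a) (hb : 0 < b) (hr : 0 < r)
    (h1 : a ≤ b + r) (h2 : b ≤ a + r) (h3 : r ≤ a + b) :
    a * Complex.exp (-triangleAngle a b r * Complex.I) +
      b * Complex.exp (triangleAngle b a r * Complex.I) = r := by
  have h := congrArg (starRingEnd ℂ) (triangleAngle_add ha hb hr h1 h2 h3)
  simpa [← Complex.exp_conj] using h

theorem triangleAngle_of_eq_add {a b : ℝ} (ha : 0 < a) (hb : 0 < b) :
    triangleAngle a b (a + b) = 0 := by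
  have : ((a + b) ^ 2 + a ^ 2 - b ^ 2) / (2 * a * (a + b)) = 1 := by
    rw [div_eq_one_iff_eq (by positivity)]; ring
  rw [triangleAngle, this, Real.arccos_one]

/-- Three nonnegative lengths satisfying the triangle inequalities are the sides of a triangle. -/
theorem exists_triangle {a b r : ℝ} (ha : 0 ≤ a) (hb : 0 ≤ b) (hr : 0 ≤ r)
    (h1 : a ≤ b + r) (h2 : b ≤ a + r) (h3 : r ≤ a + b) :
    ∃ A B : ℝ, a * Complex.exp (A * Complex.I) + b * Complex.exp (B * Complex.I) = r := by
  rcases ha.eq_or_lt with rfl | ha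
  · obtain rfl : b = r := by linarith
    exact ⟨0, 0, by simp⟩
  rcases hb.eq_or_lt with rfl | hb
  · obtain rfl : a = r := by linarith
    exact ⟨0, 0, by simp⟩
  rcases hr.eq_or_lt with rfl | hr
  · obtain rfl : a = b := by linarith
    exact ⟨0, Real.pi, by simp [Complex.exp_pi_mul_I]⟩
  · refine ⟨triangleAngle a b r, -triangleAngle b a r, ?_⟩
    rw [Complex.ofReal_neg]
    exact triangleAngle_add ha hb hr h1 h2 h3

/-- Nonnegative lengths none of which exceeds the sum of the others are the sides of a closed
polygon; one of the sides, of length `r`, is singled out and lies on the real axis. -/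
theorem exists_polygon {ι : Type*} [DecidableEq ι] (t : ι → ℝ) (s : Finset ι) :
    (∀ j ∈ s, 0 ≤ t j) → ∀ r : ℝ, 0 ≤ r → r ≤ ∑ j ∈ s, t j →
      (∀ j ∈ s, 2 * t j ≤ r + ∑ j ∈ s, t j) →
      ∃ φ : ι → ℝ, ∑ j ∈ s, (t j : ℂ) * Complex.exp (φ j * Complex.I) = r := by
  induction s using Finset.induction_on_max_value t with
  | empty =>
    intro _ r h0 h1 _
    refine ⟨0, ?_⟩
    have : r = 0 := le_antisymm (by simpa using h1) h0
    simp [this]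
  | insert m s hm hmax ih =>
    intro ht r h0 h1 h2
    have hs : ∀ j ∈ s, 0 ≤ t j := fun j hj => ht j (Finset.mem_insert_of_mem hj)
    have htm := ht m (Finset.mem_insert_self _ _)
    have h2m := h2 m (Finset.mem_insert_self _ _)
    rw [Finset.sum_insert hm] at h1 h2m
    have hS : 0 ≤ ∑ j ∈ s, t j := Finset.sum_nonneg hs
    -- Let the shorter sides close up to the largest resultant that still fits in a triangle with `t
    -- m` and `r`; as `t m` is maximal, the polygon inequalities survive.
    obtain ⟨φ, hφ⟩ := ih hs (min (∑ j ∈ s, t j) (t m + r)) (le_min hS (by linarith))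
      (min_le_left _ _) (by
        intro j hj
        have := Finset.single_le_sum hs hj
        have := hmax j hj
        rcases min_cases (∑ j ∈ s, t j) (t m + r) with h | h <;> linarith)
    obtain ⟨A, B, hAB⟩ := exists_triangle (a := t m) (b := min (∑ j ∈ s, t j) (t m + r)) (r := r)
      htm (le_min hS (by linarith)) h0
      (by rcases min_cases (∑ j ∈ s, t j) (t m + r) with h | h <;> linarith)
      (min_le_right _ _)
      (by rcases min_cases (∑ j ∈ s, t j) (t m + r) with h | h <;> linarith)
    refine ⟨fun j => if j = m then A else φ j + B, ?_⟩
    beta_reduce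
    rw [Finset.sum_insert hm, ← hAB, ← hφ, if_pos rfl, Finset.sum_mul]
    congr 1
    refine Finset.sum_congr rfl fun j hj => ?_
    rw [if_neg (ne_of_mem_of_not_mem hj hm), mul_assoc, ← Complex.exp_add]
    push_cast
    ring_nf

/-! ### Four-bar linkages -/

/-- The remaining vector of a four-bar linkage with base `C` and crank `ρ`. -/
noncomputable def crankVector (C ρ x : ℝ) : ℂ := C - ρ * Complex.exp (x * Complex.I)

theorem crankVector_re (C ρ x : ℝ) : (crankVector C ρ x).re = C - ρ * Real.cos x := by
  simp [crankVector, Complex.exp_mul_I, ← Complex.ofReal_cos, ← Complex.ofReal_sin]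

theorem crankVector_im (C ρ x : ℝ) : (crankVector C ρ x).im = -(ρ * Real.sin x) := by
  simp [crankVector, Complex.exp_mul_I, ← Complex.ofReal_cos, ← Complex.ofReal_sin]

theorem norm_crankVector_sq (C ρ x : ℝ) :
    ‖crankVector C ρ x‖ ^ 2 = C ^ 2 + ρ ^ 2 - 2 * C * ρ * Real.cos x := by
  rw [Complex.sq_norm, Complex.normSq_apply, crankVector_re, crankVector_im]
  linear_combination ρ ^ 2 * Real.sin_sq_add_cos_sq x

/-- A crank shorter than the base keeps the remaining vector in the right half-plane, where the
principal argument is continuous. -/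
theorem crankVector_re_pos {C ρ : ℝ} (hρ : 0 ≤ ρ) (h : ρ < C) (x : ℝ) :
    0 < (crankVector C ρ x).re := by
  rw [crankVector_re]
  nlinarith [Real.cos_le_one x]

theorem continuous_crankVector (C ρ : ℝ) : Continuous (crankVector C ρ) := by
  unfold crankVector
  fun_prop

theorem continuous_arg_crankVector {C ρ : ℝ} (hρ : 0 ≤ ρ) (h : ρ < C) :
    Continuous fun x => (crankVector C ρ x).arg :=
  continuous_iff_continuousAt.2 fun x =>
    (Complex.continuousAt_arg (Or.inl (crankVector_re_pos hρ h x))).comp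
      (continuous_crankVector C ρ).continuousAt

theorem norm_crankVector_pos {C ρ : ℝ} (hρ : 0 ≤ ρ) (h : ρ < C) (x : ℝ) :
    0 < ‖crankVector C ρ x‖ :=
  (crankVector_re_pos hρ h x).trans_le (Complex.re_le_norm _)

theorem sub_le_norm_crankVector {C ρ : ℝ} (hρ : 0 ≤ ρ) (x : ℝ) :
    C - ρ ≤ ‖crankVector C ρ x‖ := by
  refine le_trans ?_ (Complex.re_le_norm _)
  rw [crankVector_re]
  nlinarith [Real.cos_le_one x]

theorem norm_crankVector_le {C ρ : ℝ} (hρ : 0 ≤ ρ) (hC : 0 ≤ C) (x : ℝ) :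
    ‖crankVector C ρ x‖ ≤ C + ρ := by
  refine (norm_sub_le _ _).trans ?_
  simp [Complex.norm_exp_ofReal_mul_I, abs_of_nonneg, hρ, hC]

theorem continuous_triangleAngle_crankVector {a b C ρ : ℝ} (ha : 0 < a) (hρ : 0 ≤ ρ)
    (h : ρ < C) : Continuous fun x => triangleAngle a b ‖crankVector C ρ x‖ := by
  unfold triangleAngle
  have h1 := (continuous_crankVector C ρ).norm
  refine Real.continuous_arccos.comp (Continuous.div (by fun_prop) (by fun_prop) fun x => ?_)
  have := norm_crankVector_pos hρ h x
  positivity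

/-- The weighted sum of the phases of the four-bar linkage with base `C`, crank `ρ` in direction `x`
and remaining sides `a`, `b`; the two assembly modes are distinguished by the sign `ε`. -/
noncomputable def linkagePhase (a b C ρ p q r ε x : ℝ) : ℝ :=
  p * ((crankVector C ρ x).arg + ε * triangleAngle a b ‖crankVector C ρ x‖) +
    q * ((crankVector C ρ x).arg - ε * triangleAngle b a ‖crankVector C ρ x‖) + r * x

theorem continuous_linkagePhase {a b C ρ : ℝ} (ha : 0 < a) (hb : 0 < b) (hρ : 0 ≤ ρ)
    (h : ρ < C) (p q r ε : ℝ) : Continuous (linkagePhase a b C ρ p q r ε) := by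
  have h1 := continuous_arg_crankVector hρ h
  have h2 := continuous_triangleAngle_crankVector (b := b) ha hρ h
  have h3 := continuous_triangleAngle_crankVector (b := a) hb hρ h
  unfold linkagePhase
  fun_prop

/-- The triangle over the base `‖crankVector C ρ x‖` is rotated by the argument of that vector.
Since its norm is at least `C - ρ`, only the third triangle inequality depends on `x`. -/
theorem linkage_closes {a b C ρ x ε : ℝ} (ha : 0 < a) (hb : 0 < b) (hρ : 0 ≤ ρ) (h : ρ < C)
    (h1 : a ≤ b + (C - ρ)) (h2 : b ≤ a + (C - ρ)) (h3 : ‖crankVector C ρ x‖ ≤ a + b)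
    (hε : ε = 1 ∨ ε = -1) :
    (a : ℂ) * Complex.exp (((crankVector C ρ x).arg +
        ε * triangleAngle a b ‖crankVector C ρ x‖ : ℝ) * Complex.I) +
      b * Complex.exp (((crankVector C ρ x).arg -
        ε * triangleAngle b a ‖crankVector C ρ x‖ : ℝ) * Complex.I) +
      ρ * Complex.exp (x * Complex.I) = C := by
  have hlow := sub_le_norm_crankVector (C := C) hρ x
  have hpos := norm_crankVector_pos hρ h x
  have hpolar := Complex.norm_mul_exp_arg_mul_I (crankVector C ρ x)
  have hsum : (a : ℂ) * Complex.exp ((ε * triangleAngle a b ‖crankVector C ρ x‖ : ℝ) * Complex.I) +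
      b * Complex.exp ((-(ε * triangleAngle b a ‖crankVector C ρ x‖) : ℝ) * Complex.I) =
        ‖crankVector C ρ x‖ := by
    rcases hε with rfl | rfl
    · simpa using triangleAngle_add ha hb hpos (by linarith) (by linarith) h3
    · simpa using triangleAngle_sub ha hb hpos (by linarith) (by linarith) h3
  rw [sub_eq_add_neg, Complex.ofReal_add, Complex.ofReal_add, add_mul, add_mul, Complex.exp_add,
    Complex.exp_add]
  have hdef : crankVector C ρ x = C - ρ * Complex.exp (x * Complex.I) := rfl
  linear_combination Complex.exp ((crankVector C ρ x).arg * Complex.I) * hsum + hpolar + hdef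

/-- If the crank of a four-bar linkage turns fully, the weighted phase takes every value. -/
theorem exists_linkage_of_full_turn {a b C ρ : ℝ} (ha : 0 < a) (hb : 0 < b) (hρ : 0 ≤ ρ)
    (h : ρ < C) (h1 : a ≤ b + (C - ρ)) (h2 : b ≤ a + (C - ρ)) (h3 : C + ρ ≤ a + b)
    (p q : ℝ) {r : ℝ} (hr : 0 < r) (κ : ℝ) :
    ∃ A B x : ℝ, (a : ℂ) * Complex.exp (A * Complex.I) + b * Complex.exp (B * Complex.I) +
      ρ * Complex.exp (x * Complex.I) = C ∧ p * A + q * B + r * x = κ := by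
  have hcont := continuous_linkagePhase ha hb hρ h p q r 1
  obtain ⟨M, hM⟩ : ∃ M, ∀ x, |linkagePhase a b C ρ p q r 1 x - r * x| ≤ M := by
    refine ⟨|p| * (Real.pi + Real.pi) + |q| * (Real.pi + Real.pi), fun x => ?_⟩
    have e1 := Complex.abs_arg_le_pi (crankVector C ρ x)
    have e2 : ∀ u v, |triangleAngle u v ‖crankVector C ρ x‖| ≤ Real.pi := fun u v => by
      rw [triangleAngle, abs_of_nonneg (Real.arccos_nonneg _)]
      exact Real.arccos_le_pi _
    rw [linkagePhase, add_sub_cancel_right, one_mul, one_mul]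
    refine (abs_add_le _ _).trans (add_le_add ?_ ?_) <;> rw [abs_mul]
    · gcongr
      exact (abs_add_le _ _).trans (add_le_add e1 (e2 _ _))
    · gcongr
      exact (abs_sub _ _).trans (add_le_add e1 (e2 _ _))
  have hκ : κ ∈ Set.range (linkagePhase a b C ρ p q r 1) := by
    refine mem_range_of_exists_le_of_exists_ge hcont ⟨(κ - M) / r, ?_⟩ ⟨(κ + M) / r, ?_⟩
    · have := (abs_le.1 (hM ((κ - M) / r))).2
      rw [mul_div_cancel₀ _ hr.ne'] at this
      linarith
    · have := (abs_le.1 (hM ((κ + M) / r))).1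
      rw [mul_div_cancel₀ _ hr.ne'] at this
      linarith
  obtain ⟨x, hx⟩ := hκ
  exact ⟨_, _, x, linkage_closes ha hb hρ h h1 h2
    ((norm_crankVector_le hρ (hρ.trans h.le) x).trans h3) (Or.inl rfl), hx⟩

/-- If the crank of a four-bar linkage does not turn fully, a configuration moves to its mirror
image, and the weighted phase vanishes on the way. -/
theorem exists_linkage_of_dead_point {a b C ρ : ℝ} (ha : 0 < a) (hb : 0 < b) (hρ : 0 < ρ)
    (h : ρ < C) (h1 : a ≤ b + (C - ρ)) (h2 : b ≤ a + (C - ρ)) (h3 : a + b ≤ C + ρ)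
    (h4 : C ≤ a + b + ρ) (p q r : ℝ) :
    ∃ A B x : ℝ, (a : ℂ) * Complex.exp (A * Complex.I) + b * Complex.exp (B * Complex.I) +
      ρ * Complex.exp (x * Complex.I) = C ∧ p * A + q * B + r * x = 0 := by
  have hpos : 0 < 2 * C * ρ := by have := hρ.trans h; positivity
  -- Dead point: by the law of cosines, the crank angle at which `a` and `b` are stretched into a
  -- segment.
  set y := Real.arccos ((C ^ 2 + ρ ^ 2 - (a + b) ^ 2) / (2 * C * ρ)) with hy
  have hcos : Real.cos y = (C ^ 2 + ρ ^ 2 - (a + b) ^ 2) / (2 * C * ρ) := by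
    rw [hy, Real.cos_arccos]
    · rw [le_div_iff₀ hpos]; nlinarith
    · rw [div_le_iff₀ hpos]; nlinarith
  have hy0 : 0 ≤ y := Real.arccos_nonneg _
  have hcos' : 2 * C * ρ * Real.cos y = C ^ 2 + ρ ^ 2 - (a + b) ^ 2 := by
    rw [hcos, mul_div_cancel₀ _ hpos.ne']
  have hnorm : ‖crankVector C ρ y‖ = a + b := by
    rw [← sq_eq_sq₀ (norm_nonneg _) (by positivity), norm_crankVector_sq, hcos']
    ring
  have hle : ∀ x ∈ Set.Icc 0 y, ‖crankVector C ρ x‖ ≤ a + b := by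
    intro x hx
    rw [← sq_le_sq₀ (norm_nonneg _) (by positivity), norm_crankVector_sq]
    have := Real.cos_le_cos_of_nonneg_of_le_pi hx.1 (Real.arccos_le_pi _) hx.2
    nlinarith
  have key : ∀ ε, (ε = 1 ∨ ε = -1) → ∀ x ∈ Set.Icc 0 y,
      linkagePhase a b C ρ p q r ε x = 0 →
      ∃ A B x : ℝ, (a : ℂ) * Complex.exp (A * Complex.I) + b * Complex.exp (B * Complex.I) +
        ρ * Complex.exp (x * Complex.I) = C ∧ p * A + q * B + r * x = 0 :=
    fun ε hε x hx hF => ⟨_, _, x, linkage_closes ha hb hρ.le h h1 h2 (hle x hx) hε, hF⟩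
  have hstart : linkagePhase a b C ρ p q r (-1) 0 = -linkagePhase a b C ρ p q r 1 0 := by
    have : (crankVector C ρ 0).arg = 0 := by
      have : crankVector C ρ 0 = ((C - ρ : ℝ) : ℂ) := by simp [crankVector]
      rw [this, Complex.arg_ofReal_of_nonneg (by linarith)]
    simp only [linkagePhase, this]
    ring
  have hend : linkagePhase a b C ρ p q r (-1) y = linkagePhase a b C ρ p q r 1 y := by
    simp only [linkagePhase, hnorm, triangleAngle_of_eq_add ha hb]
    rw [add_comm a b, triangleAngle_of_eq_add hb ha]
    ring
  have hivt : ∀ ε, (ε = 1 ∨ ε = -1) →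
      (0 : ℝ) ∈ Set.uIcc (linkagePhase a b C ρ p q r ε 0) (linkagePhase a b C ρ p q r ε y) →
      ∃ A B x : ℝ, (a : ℂ) * Complex.exp (A * Complex.I) + b * Complex.exp (B * Complex.I) +
        ρ * Complex.exp (x * Complex.I) = C ∧ p * A + q * B + r * x = 0 := by
    intro ε hε h0
    obtain ⟨x, hx, hF⟩ := intermediate_value_uIcc
      (continuous_linkagePhase ha hb hρ.le h p q r ε).continuousOn h0
    rw [Set.uIcc_of_le hy0] at hx
    exact key ε hε x hx hF
  -- The two modes have opposite values at `0` and equal values at `y`, so one of them changes sign.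
  rcases le_total 0 (linkagePhase a b C ρ p q r 1 0) with g | g <;>
    rcases le_total 0 (linkagePhase a b C ρ p q r 1 y) with g' | g'
  · exact hivt (-1) (Or.inr rfl) (Set.mem_uIcc.2 (Or.inl ⟨by linarith, by linarith⟩))
  · exact hivt 1 (Or.inl rfl) (Set.mem_uIcc.2 (Or.inr ⟨by linarith, by linarith⟩))
  · exact hivt 1 (Or.inl rfl) (Set.mem_uIcc.2 (Or.inl ⟨by linarith, by linarith⟩))
  · exact hivt (-1) (Or.inr rfl) (Set.mem_uIcc.2 (Or.inr ⟨by linarith, by linarith⟩))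

/-! ### Phases with vanishing weighted sum -/

/-- Phases of a four-bar linkage, one of whose sides is a rigid group of vectors, give phases of the
individual vectors. -/
theorem exists_phases_of_linkage {ι : Type*} [DecidableEq ι] {t l : ι → ℝ} {J : Finset ι} {C ρ : ℝ}
    {i k : ι} (hi : i ∈ J) (hk : k ∈ J.erase i) {g : ι → ℝ}
    (hg : ∑ j ∈ (J.erase i).erase k, (t j : ℂ) * Complex.exp (g j * Complex.I) = ρ)
    (h : ∃ A B x : ℝ, (t i : ℂ) * Complex.exp (A * Complex.I) +
        t k * Complex.exp (B * Complex.I) + ρ * Complex.exp (x * Complex.I) = C ∧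
      l i * A + l k * B + (∑ j ∈ (J.erase i).erase k, l j) * x =
        -∑ j ∈ (J.erase i).erase k, l j * g j) :
    ∃ φ : ι → ℝ, ∑ j ∈ J, (t j : ℂ) * Complex.exp (φ j * Complex.I) = C ∧
      ∑ j ∈ J, l j * φ j = 0 := by
  obtain ⟨A, B, x, h1, h2⟩ := h
  have hki : k ≠ i := Finset.ne_of_mem_erase hk
  refine ⟨fun j => if j = i then A else if j = k then B else g j + x, ?_, ?_⟩
  · beta_reduce
    rw [← Finset.add_sum_erase _ _ hi, ← Finset.add_sum_erase _ _ hk, ← h1, ← hg, Finset.sum_mul,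
      if_pos rfl, if_neg hki, if_pos rfl, add_assoc]
    congr 2
    refine Finset.sum_congr rfl fun j hj => ?_
    rw [if_neg (Finset.ne_of_mem_erase (Finset.mem_of_mem_erase hj)),
      if_neg (Finset.ne_of_mem_erase hj), mul_assoc, ← Complex.exp_add]
    push_cast
    ring_nf
  · beta_reduce
    rw [← Finset.add_sum_erase _ _ hi, ← Finset.add_sum_erase _ _ hk, if_pos rfl, if_neg hki,
      if_pos rfl]
    have : ∀ j ∈ (J.erase i).erase k,
        l j * (if j = i then A else if j = k then B else g j + x) = l j * g j + l j * x := by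
      intro j hj
      rw [if_neg (Finset.ne_of_mem_erase (Finset.mem_of_mem_erase hj)),
        if_neg (Finset.ne_of_mem_erase hj), mul_add]
    rw [Finset.sum_congr rfl this, Finset.sum_add_distrib, ← Finset.sum_mul]
    linarith

/-- Three vectors of lengths at most `C` and total length at least `C` have phases with vanishing
weighted sum for which the vectors sum to `C`. -/
theorem exists_phases_of_card_eq_three {ι : Type*} [DecidableEq ι] {t l : ι → ℝ} {J : Finset ι}
    {C : ℝ} {i k m : ι} (hi : i ∈ J) (hk : k ∈ J.erase i) (hm : (J.erase i).erase k = {m})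
    (htm : 0 < t m) (hlm : 0 < l m) (hlk : 0 < l k) (hmk : t m ≤ t k) (hkm : t k ≤ t i)
    (hC : t i ≤ C) (hsum : C ≤ t i + t k + t m) :
    ∃ φ : ι → ℝ, ∑ j ∈ J, (t j : ℂ) * Complex.exp (φ j * Complex.I) = C ∧
      ∑ j ∈ J, l j * φ j = 0 := by
  have hg : ∑ j ∈ (J.erase i).erase k, (t j : ℂ) * Complex.exp ((0 : ℝ) * Complex.I) = t m := by
    simp [hm]
  -- Reference phase `0` makes the target value `0`, the only one the dead-point argument reaches.
  refine exists_phases_of_linkage (g := fun _ => 0) hi hk hg ?_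
  simp only [hm, Finset.sum_singleton, mul_zero, neg_zero]
  rcases (hmk.trans (hkm.trans hC)).eq_or_lt with hmC | hmC
  -- All lengths equal `C`, and the crank vector could vanish. Instead one vector gives `C` and the
  -- other two cancel; the weights fix their direction.
  · have e1 : t k = C := by linarith
    have e2 : t i = C := by linarith
    refine ⟨0, -(l m * Real.pi) / (l k + l m), -(l m * Real.pi) / (l k + l m) + Real.pi, ?_, ?_⟩
    · rw [hmC, e1, e2, Complex.ofReal_add, add_mul, Complex.exp_add, Complex.exp_pi_mul_I]
      simp
    · have : l k + l m ≠ 0 := by positivity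
      field_simp
      ring
  · have hk0 : 0 < t k := by linarith
    have hi0 : 0 < t i := by linarith
    rcases le_total (C + t m) (t i + t k) with h | h
    · exact exists_linkage_of_full_turn hi0 hk0 htm.le hmC (by linarith) (by linarith) h _ _ hlm _
    · exact exists_linkage_of_dead_point hi0 hk0 htm hmC (by linarith) (by linarith) h
        (by linarith) _ _ _

/-- If at least four vectors have lengths at most `C` and the longest and the shortest length add up
to more than `C`, then there are phases with vanishing weighted sum for which the vectors sum to
`C`. -/
theorem exists_phases_of_lt_add {ι : Type*} [DecidableEq ι] {t l : ι → ℝ} {J : Finset ι}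
    {C : ℝ} {i k m : ι} (hi : i ∈ J) (hk : k ∈ J.erase i) (hm : m ∈ (J.erase i).erase k)
    (hne : (((J.erase i).erase k).erase m).Nonempty) (ht : ∀ j ∈ J, 0 < t j)
    (hl : ∀ j ∈ J, 0 < l j) (hmin : ∀ j ∈ J, t m ≤ t j) (hki : t k ≤ t i)
    (hmax : ∀ j ∈ (J.erase i).erase k, t j ≤ t k) (hC : t i ≤ C) (hlt : C < t i + t m) :
    ∃ φ : ι → ℝ, ∑ j ∈ J, (t j : ℂ) * Complex.exp (φ j * Complex.I) = C ∧
      ∑ j ∈ J, l j * φ j = 0 := by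
  set G := (J.erase i).erase k with hG
  have hGJ : ∀ j ∈ G, j ∈ J := fun j hj => Finset.mem_of_mem_erase (Finset.mem_of_mem_erase hj)
  have htG : ∀ j ∈ G, 0 ≤ t j := fun j hj => (ht j (hGJ j hj)).le
  obtain ⟨q, hq, hqmax⟩ := Finset.exists_max_image _ t hne
  have hqG := Finset.mem_of_mem_erase hq
  have htm := ht m (hGJ m hm)
  have hsum : t q + t m ≤ ∑ j ∈ G, t j := by
    rw [← Finset.add_sum_erase _ _ hm, add_comm]
    gcongr
    exact Finset.single_le_sum (fun j hj => htG j (Finset.mem_of_mem_erase hj)) hq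
  have hqm := hmin q (hGJ q hqG)
  have hqk := hmax q hqG
  -- `ρ` is the least resultant of the group. From `ρ ≤ t q - t m` follows `C + ρ < t i + t q ≤ t i
  -- + t k`, so the crank turns fully.
  obtain ⟨ρ, hρ0, hρS, hρq, hρ⟩ : ∃ ρ : ℝ, 0 ≤ ρ ∧ ρ ≤ ∑ j ∈ G, t j ∧ ρ ≤ t q - t m ∧
      2 * t q ≤ ρ + ∑ j ∈ G, t j := by
    refine ⟨max 0 (2 * t q - ∑ j ∈ G, t j), le_max_left _ _, ?_, ?_, ?_⟩ <;>
      rcases max_cases 0 (2 * t q - ∑ j ∈ G, t j) with h | h <;> linarith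
  obtain ⟨g, hg⟩ := exists_polygon t G htG ρ hρ0 hρS (by
    intro j hj
    rcases eq_or_ne j m with rfl | hjm
    · linarith
    · linarith [hqmax j (Finset.mem_erase.2 ⟨hjm, hj⟩)])
  have hi0 := ht i hi
  have hk0 := ht k (Finset.mem_of_mem_erase hk)
  exact exists_phases_of_linkage hi hk hg (exists_linkage_of_full_turn hi0 hk0 hρ0 (by linarith)
    (by linarith) (by linarith) (by linarith) _ _
    (Finset.sum_pos (fun j hj => hl j (hGJ j hj)) ⟨m, hm⟩) _)

/-- At least three vectors of lengths at most `C` and total length at least `C` have phases with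
vanishing weighted sum for which the vectors sum to `C`. -/
theorem exists_phases {ι : Type*} [DecidableEq ι] {t l : ι → ℝ} (N : ℕ) :
    ∀ (J : Finset ι) (C : ℝ), J.card = N + 3 → (∀ j ∈ J, 0 < t j) → (∀ j ∈ J, 0 < l j) →
      (∀ j ∈ J, t j ≤ C) → C ≤ ∑ j ∈ J, t j →
      ∃ φ : ι → ℝ, ∑ j ∈ J, (t j : ℂ) * Complex.exp (φ j * Complex.I) = C ∧
        ∑ j ∈ J, l j * φ j = 0 := by
  induction N with
  | zero =>
    intro J C hJ ht hl hC hS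
    obtain ⟨i, hi, himax⟩ := J.exists_max_image t (Finset.card_pos.1 (by omega))
    have c1 := Finset.card_erase_of_mem hi
    obtain ⟨k, hk, hkmax⟩ := (J.erase i).exists_max_image t (Finset.card_pos.1 (by omega))
    have c2 := Finset.card_erase_of_mem hk
    obtain ⟨m, hm⟩ := Finset.card_eq_one.1 (by omega : ((J.erase i).erase k).card = 1)
    have hm1 : m ∈ (J.erase i).erase k := by simp [hm]
    have hm2 := Finset.mem_of_mem_erase hm1
    have hm3 := Finset.mem_of_mem_erase hm2
    have hk2 := Finset.mem_of_mem_erase hk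
    rw [← Finset.add_sum_erase _ _ hi, ← Finset.add_sum_erase _ _ hk, hm, Finset.sum_singleton,
      ← add_assoc] at hS
    exact exists_phases_of_card_eq_three hi hk hm (ht m hm3) (hl m hm3) (hl k hk2) (hkmax m hm2)
      (himax k hk2) (hC i hi) hS
  | succ N ih =>
    intro J C hJ ht hl hC hS
    obtain ⟨m, hm, hmin⟩ := J.exists_min_image t (Finset.card_pos.1 (by omega))
    have c1 := Finset.card_erase_of_mem hm
    by_cases hdrop : ∀ j ∈ J.erase m, t j ≤ C - t m
    · rw [← Finset.add_sum_erase _ _ hm] at hS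
      obtain ⟨φ, h1, h2⟩ := ih (J.erase m) (C - t m) (by omega)
        (fun j hj => ht j (Finset.mem_of_mem_erase hj))
        (fun j hj => hl j (Finset.mem_of_mem_erase hj)) hdrop (by linarith)
      have hφ : ∀ j ∈ J.erase m, Function.update φ m 0 j = φ j := fun j hj =>
        Function.update_of_ne (Finset.ne_of_mem_erase hj) _ _
      refine ⟨Function.update φ m 0, ?_, ?_⟩
      · rw [← Finset.add_sum_erase _ _ hm, Finset.sum_congr rfl fun j hj => by rw [hφ j hj], h1]
        simp
      · rw [← Finset.add_sum_erase _ _ hm, Finset.sum_congr rfl fun j hj => by rw [hφ j hj], h2]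
        simp
    · push Not at hdrop
      obtain ⟨j, hj, hjC⟩ := hdrop
      obtain ⟨i, hi, himax⟩ := (J.erase m).exists_max_image t ⟨j, hj⟩
      have c2 := Finset.card_erase_of_mem hi
      obtain ⟨k, hk, hkmax⟩ := ((J.erase m).erase i).exists_max_image t
        (Finset.card_pos.1 (by omega))
      have c3 := Finset.card_erase_of_mem hk
      have hmi := Finset.ne_of_mem_erase hi
      have hki := Finset.ne_of_mem_erase hk
      have hk1 := Finset.mem_of_mem_erase hk
      have hkm := Finset.ne_of_mem_erase hk1
      have hiJ := Finset.mem_of_mem_erase hi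
      have hkJ := Finset.mem_of_mem_erase hk1
      have he : ((J.erase i).erase k).erase m = ((J.erase m).erase i).erase k := by
        rw [Finset.erase_right_comm, Finset.erase_right_comm (a := i)]
      refine exists_phases_of_lt_add (m := m) hiJ (Finset.mem_erase.2 ⟨hki, hkJ⟩)
        (by simp [hm, hmi.symm, hkm.symm]) ?_ ht hl hmin (himax k hk1) ?_ (hC i hiJ)
        (by linarith [himax j hj])
      · rw [he]
        exact Finset.card_pos.1 (by omega)
      · intro q hq
        rcases eq_or_ne q m with rfl | hqm
        · exact hmin k hkJ
        · refine hkmax q ?_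
          simp only [Finset.mem_erase] at hq ⊢
          tauto

/-! ### From phases to the torus -/

/-- `0` is a combination, with positive weights, of the vertices of a simplex around it, and phases
annihilated by these weights come from a linear functional. -/
theorem exists_weights_of_mem_interior {n : ℕ} {p : Fin (n + 1) → Fin n → ℝ}
    (h : (0 : Fin n → ℝ) ∈ interior (convexHull ℝ (Set.range p))) :
    ∃ l : Fin (n + 1) → ℝ, (∀ j, 0 < l j) ∧
      ∀ φ : Fin (n + 1) → ℝ, ∑ j, l j * φ j = 0 →
        ∃ θ : Fin n → ℝ, ∀ j, ∑ i, θ i * p j i = φ j := by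
  have htop : affineSpan ℝ (Set.range p) = ⊤ :=
    interior_convexHull_nonempty_iff_affineSpan_eq_top.1 ⟨0, h⟩
  have hind : AffineIndependent ℝ p := by
    rw [affineIndependent_iff_finrank_vectorSpan_eq ℝ p (Fintype.card_fin (n + 1)),
      ← direction_affineSpan, htop, AffineSubspace.direction_top, finrank_top]
    simp
  let B : AffineBasis (Fin (n + 1)) ℝ (Fin n → ℝ) := ⟨p, hind, htop⟩
  have hB : ∀ j, B j = p j := fun _ => rfl
  refine ⟨fun j => B.coord j 0, ?_, fun φ hφ => ?_⟩
  · have h' : (0 : Fin n → ℝ) ∈ interior (convexHull ℝ (Set.range B)) := h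
    rw [AffineBasis.interior_convexHull] at h'
    exact h'
  -- The affine function with value `φ j` at vertex `j`; its value at `0` is the weighted sum, so it
  -- is linear and `θ` is its coefficient vector.
  · let f : (Fin n → ℝ) →ᵃ[ℝ] ℝ := ∑ j, φ j • B.coord j
    have hf : ∀ x, f x = ∑ j, φ j * B.coord j x := by
      intro x
      change (∑ j, φ j • B.coord j : (Fin n → ℝ) →ᵃ[ℝ] ℝ) x = _
      induction (Finset.univ : Finset (Fin (n + 1))) using Finset.induction_on with
      | empty => simp
      | insert a s ha ih => rw [Finset.sum_insert ha, Finset.sum_insert ha, ← ih]; rfl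
    have hf0 : f 0 = 0 := by
      rw [hf, ← hφ]
      exact Finset.sum_congr rfl fun j _ => mul_comm _ _
    refine ⟨fun i => f.linear (Pi.single i 1), fun j => ?_⟩
    have h1 : f (p j) = φ j := by
      rw [hf, Finset.sum_eq_single j]
      · rw [← hB, B.coord_apply_eq, mul_one]
      · intro k _ hk
        rw [← hB, B.coord_apply_ne hk, mul_zero]
      · simp
    have h2 : f.linear (p j) = f (p j) := by
      have := congrFun f.decomp (p j)
      simp only [Pi.add_apply, hf0, add_zero] at this
      exact this.symm
    rw [← h1, ← h2, LinearMap.pi_apply_eq_sum_univ f.linear (p j)]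
    refine Finset.sum_congr rfl fun i _ => ?_
    have hsingle : (Pi.single i 1 : Fin n → ℝ) = fun k => if i = k then 1 else 0 := by
      ext k
      simp [Pi.single_apply, eq_comm]
    beta_reduce
    rw [smul_eq_mul, mul_comm, hsingle]

theorem laurentEval_eq_sum {n : ℕ} (f : MvLaurent n) (z : Fin n → ℂˣ) :
    laurentEval f z = f.coeff.sum fun a r => r * monomialValue a z := rfl

theorem laurentEval_add {n : ℕ} (f g : MvLaurent n) (z : Fin n → ℂˣ) :
    laurentEval (f + g) z = laurentEval f z + laurentEval g z := by
  simp only [laurentEval_eq_sum, AddMonoidAlgebra.coeff_add]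
  exact Finsupp.sum_add_index' (fun _ => zero_mul _) fun _ _ _ => add_mul _ _ _

theorem laurentEval_single {n : ℕ} (a : Fin n → ℤ) (r : ℂ) (z : Fin n → ℂˣ) :
    laurentEval (AddMonoidAlgebra.single a r) z = r * monomialValue a z := by
  rw [laurentEval_eq_sum, AddMonoidAlgebra.coeff_single]
  exact Finsupp.sum_single_index (zero_mul _)

theorem laurentEval_sum {n : ℕ} {ι : Type*} (s : Finset ι) (f : ι → MvLaurent n)
    (z : Fin n → ℂˣ) : laurentEval (∑ j ∈ s, f j) z = ∑ j ∈ s, laurentEval (f j) z := by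
  classical
  induction s using Finset.induction_on with
  | empty => simp [laurentEval]
  | insert a s ha ih => rw [Finset.sum_insert ha, Finset.sum_insert ha, laurentEval_add, ih]

theorem laurentEval_circuitLaurent {n : ℕ} (α : Fin (n + 1) → Fin n → ℤ) (b : Fin (n + 1) → ℝ)
    (c : ℝ) (z : Fin n → ℂˣ) :
    laurentEval (circuitLaurent α b c) z = ∑ j, (b j : ℂ) * monomialValue (α j) z + c := by
  simp [circuitLaurent, laurentEval_add, laurentEval_sum, laurentEval_single, monomialValue]

theorem monomialValue_fiberPoint {n : ℕ} (a : Fin n → ℤ) (w θ : Fin n → ℝ) :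
    monomialValue a (fiberPoint w fun i => Circle.exp (θ i)) =
      (Real.exp (∑ i, w i * (a i : ℝ)) : ℂ) *
        Complex.exp ((∑ i, θ i * (a i : ℝ) : ℝ) * Complex.I) := by
  simp only [monomialValue, fiberPoint, Units.val_mk0, Circle.coe_exp, ← Complex.exp_add,
    ← Complex.exp_int_mul, ← Complex.exp_sum, Complex.ofReal_exp]
  congr 1
  push_cast
  rw [Finset.sum_mul, ← Finset.sum_add_distrib]
  refine Finset.sum_congr rfl fun i _ => ?_
  ring

theorem logAbs_fiberPoint {n : ℕ} (w : Fin n → ℝ) (u : Fin n → Circle) :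
    logAbs (fiberPoint w u) = w := by
  ext i
  simp [logAbs, fiberPoint, Complex.norm_exp, Circle.norm_coe]

theorem mainTheorem2 (n : ℕ) (hn : 2 ≤ n) (α : Fin (n + 1) → Fin n → ℤ)
    (hα : IsCircuitAroundZero α) (b : Fin (n + 1) → ℝ) (hb : ∀ j, 0 < b j)
    (w : Fin n → ℝ) (c : ℝ) (hc : c ∈ Set.Icc (-thetaAt α b w) (-psiAt α b w)) :
    w ∈ amoeba (circuitLaurent α b c) ∧
      ∃ u : Fin n → Circle, fiberFunction (circuitLaurent α b c) w u = 0 := by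
  have hterm : ∀ j, termAbs α b w j = b j * Real.exp (∑ i, w i * (α j i : ℝ)) := fun j =>
    abs_of_pos (mul_pos (hb j) (Real.exp_pos _))
  obtain ⟨l, hl, hθ⟩ := exists_weights_of_mem_interior hα.2
  -- There are `n + 1 = (n - 2) + 3` vectors, at least three because `2 ≤ n`.
  obtain ⟨φ, hφ, hφ0⟩ := exists_phases (t := termAbs α b w) (l := l) (n - 2) Finset.univ (-c)
    (by rw [Finset.card_univ, Fintype.card_fin]; omega)
    (fun j _ => by rw [hterm]; exact mul_pos (hb j) (Real.exp_pos _)) (fun j _ => hl j)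
    (fun j hj => (Finset.le_sup' (termAbs α b w) hj).trans (le_neg_of_le_neg hc.2))
    (neg_le.1 hc.1)
  obtain ⟨θ, hθ⟩ := hθ φ hφ0
  have hzero : fiberFunction (circuitLaurent α b c) w (fun i => Circle.exp (θ i)) = 0 := by
    rw [fiberFunction, laurentEval_circuitLaurent]
    have : ∀ j ∈ Finset.univ, (b j : ℂ) *
        monomialValue (α j) (fiberPoint w fun i => Circle.exp (θ i)) =
          (termAbs α b w j : ℂ) * Complex.exp (φ j * Complex.I) := by
      intro j _
      rw [monomialValue_fiberPoint, ← hθ j, hterm, ← mul_assoc, ← Complex.ofReal_mul]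
      rfl
    rw [Finset.sum_congr rfl this, hφ]
    simp
  exact ⟨⟨_, hzero, logAbs_fiberPoint w _⟩, _, hzero⟩
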